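/- Let $[n]=\{0,\dots,n-1\}$. For positive integers $N,K$, the multi-criterion search problem is: given oracle access to an arbitrary Boolean function $f:[N]\times[K]\to\{0,1\}$, output some $j\in[K]$ with $f(i,j)=1$ for all $i\in[N]$, or output $-1$ if no such $j$ exists; on every input $f$ the output must be correct with probability at least $2/3$. A quantum query algorithm starts in a fixed basis state of a control qubit, two index registers with basis $[N]$ and $[K]$, and a workspace of arbitrary finite dimension; it alternates arbitrary unitaries independent of $f$ with queries to the controlled phase oracle $|c,i,j\rangle\mapsto(-1)^{c\,f(i,j)}|c,i,j\rangle$, where $c\in\{0,1\}$, and determines its output from a final measurement in the computational basis. Then the number of queries needed to solve multi-criterion search is $\Omega(\sqrt{NK})$: there is an absolute constant $c_0>0$ such that for all $N,K$, every quantum query algorithm that solves multi-criterion search for $f:[N]\times[K]\to\{0,1\}$ makes at least $c_0\sqrt{NK}$ queries. -/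

import Mathlib

namespace MultiCriterion

/-- Computational basis of the registers of a quantum query algorithm: a control qubit, the two
index registers holding a criterion `i` and a candidate `j`, and a workspace of dimension `d`. -/
abbrev BasisState (N K d : ℕ) : Type := Bool × (Fin N × Fin K) × Fin d

/-- The Hilbert space of the registers. -/
abbrev State (N K d : ℕ) : Type := EuclideanSpace ℂ (BasisState N K d)

/-- One query to the (controlled) phase oracle `U_f`:
`|c, i, j, w⟩ ↦ (-1)^(c · f(i,j)) |c, i, j, w⟩`. -/
noncomputable def query {N K d : ℕ} (f : Fin N × Fin K → Bool) (ψ : State N K d) : State N K d :=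
  WithLp.toLp 2 fun b => (if b.1 && f b.2.1 then (-1 : ℂ) else 1) * ψ b

/-- A quantum query algorithm with oracle access to a Boolean function on `[N] × [K]`.
The output is `some j` for the candidate `j` and `none` for the answer `-1`. -/
structure QueryAlgorithm (N K : ℕ) where
  /-- Dimension of the workspace. -/
  workDim : ℕ
  /-- Number of oracle queries. -/
  queries : ℕ
  /-- Initial basis state. -/
  start : BasisState N K workDim
  /-- The oracle-independent unitaries; `step t` is applied after the `t`-th query, and only
  `step 0, …, step queries` are used. -/
  step : ℕ → (State N K workDim ≃ₗᵢ[ℂ] State N K workDim)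
  /-- The answer returned for each result of the final computational-basis measurement. -/
  readout : BasisState N K workDim → Option (Fin K)

namespace QueryAlgorithm

variable {N K : ℕ}

/-- The state `V_t U_f V_{t-1} U_f ⋯ U_f V_0 |start⟩` after `t` queries. -/
noncomputable def stateAfter (A : QueryAlgorithm N K) (f : Fin N × Fin K → Bool) :
    ℕ → State N K A.workDim
  | 0 => A.step 0 (EuclideanSpace.single A.start 1)
  | t + 1 => A.step (t + 1) (query f (A.stateAfter f t))

open Classical in
/-- Probability that the algorithm, run with the oracle for `f`, returns an answer in `S`. -/
noncomputable def outputProb (A : QueryAlgorithm N K) (f : Fin N × Fin K → Bool)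
    (S : Set (Option (Fin K))) : ℝ :=
  ∑ b with A.readout b ∈ S, ‖A.stateAfter f A.queries b‖ ^ 2

end QueryAlgorithm

/-- The correct answers to multi-criterion search on `f`: any `j` with `f(i,j) = 1` for all `i`,
and `-1` if there is no such `j`. -/
def correctAnswers {N K : ℕ} (f : Fin N × Fin K → Bool) : Set (Option (Fin K)) :=
  {r | match r with
    | some j => ∀ i, f (i, j) = true
    | none => ¬ ∃ j, ∀ i, f (i, j) = true}

/-- The algorithm solves multi-criterion search with bounded error: on every input its answer is
correct with probability at least `2/3`. -/
def SolvesMultiCriterionSearch {N K : ℕ} (A : QueryAlgorithm N K) : Prop :=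
  ∀ f : Fin N × Fin K → Bool, 2 / 3 ≤ A.outputProb f (correctAnswers f)

end MultiCriterion

namespace MultiCriterion

open Finset

variable {N K d : ℕ}

/-! Weighted adversary argument. An input with one zero per column has answer `-1`; filling the zero
of column `k` makes `k` the only answer. The two runs start with overlap 1 and must end with overlap
at most 17/18, and each query lowers it only through the mass both states place on the flipped entry
(`norm_inner_le_query`). Averaged over the zero positions and summed over `k`, that mass is at most
1 on the unfilled side and `K / N` on the filled side, where the erased zero is hidden among `N`
rows. Balancing the two gives the bound. -/

theorem norm_sq_eq_one_sum {ψ : State N K d} (h : ‖ψ‖ = 1) : ∑ b, ‖ψ b‖ ^ 2 = 1 := by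
  rw [← EuclideanSpace.norm_sq_eq, h, one_pow]

theorem norm_query (f : Fin N × Fin K → Bool) (ψ : State N K d) : ‖query f ψ‖ = ‖ψ‖ := by
  rw [EuclideanSpace.norm_eq, EuclideanSpace.norm_eq]
  congr 1
  refine sum_congr rfl fun b _ => ?_
  simp only [query, norm_mul]
  split_ifs <;> simp

theorem QueryAlgorithm.norm_stateAfter (A : QueryAlgorithm N K) (f : Fin N × Fin K → Bool) (t : ℕ) :
    ‖A.stateAfter f t‖ = 1 := by
  induction t with
  | zero => simp [QueryAlgorithm.stateAfter]
  | succ t ih => simp [QueryAlgorithm.stateAfter, norm_query, ih]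

/-- The probability weight with which a state queries the entry `p`. -/
noncomputable def queryMass (ψ : State N K d) (p : Fin N × Fin K) : ℝ :=
  ∑ w, ‖ψ (true, p, w)‖ ^ 2

theorem queryMass_nonneg (ψ : State N K d) (p : Fin N × Fin K) : 0 ≤ queryMass ψ p :=
  sum_nonneg fun _ _ => sq_nonneg _

theorem sum_queryMass_le {ψ : State N K d} (h : ‖ψ‖ = 1) : ∑ p, queryMass ψ p ≤ 1 := by
  have hsplit : ∑ b, ‖ψ b‖ ^ 2 = ∑ p, queryMass ψ p + ∑ q, ‖ψ (false, q)‖ ^ 2 := by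
    rw [Fintype.sum_prod_type, Fintype.sum_bool, Fintype.sum_prod_type (fun q => ‖ψ (true, q)‖ ^ 2)]
    rfl
  rw [← norm_sq_eq_one_sum h, hsplit]
  exact le_add_of_nonneg_right (sum_nonneg fun _ _ => sq_nonneg _)

theorem sum_queryMass_comp_le {ι : Type*} [Fintype ι] {ψ : State N K d} (h : ‖ψ‖ = 1)
    {e : ι → Fin N × Fin K} (he : Function.Injective e) : ∑ i, queryMass ψ (e i) ≤ 1 := by
  classical
  refine le_trans ?_ (sum_queryMass_le h)
  rw [← sum_image (f := queryMass ψ) fun a _ b _ hab => he hab]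
  exact sum_le_univ_sum_of_nonneg (queryMass_nonneg ψ)

theorem inner_eq_sum (φ ψ : State N K d) :
    inner ℂ φ ψ = ∑ b, ψ b * (starRingEnd ℂ) (φ b) := by
  simp [PiLp.inner_apply]

/-- One query changes the overlap of two states only through the entry where the oracles differ. -/
theorem norm_inner_le_query {f g : Fin N × Fin K → Bool} {p : Fin N × Fin K}
    (hfg : ∀ q, q ≠ p → f q = g q) (φ ψ : State N K d) {a : ℝ} (ha : 0 < a) :
    ‖inner ℂ φ ψ‖ ≤ ‖inner ℂ (query f φ) (query g ψ)‖ +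
      (a * queryMass φ p + a⁻¹ * queryMass ψ p) := by
  have key : ‖inner ℂ φ ψ - inner ℂ (query f φ) (query g ψ)‖ ≤
      a * queryMass φ p + a⁻¹ * queryMass ψ p := by
    have hsum : a * queryMass φ p + a⁻¹ * queryMass ψ p =
        ∑ b : BasisState N K d, if b.1 = true ∧ b.2.1 = p then
          a * ‖φ b‖ ^ 2 + a⁻¹ * ‖ψ b‖ ^ 2 else 0 := by
      simp only [queryMass, mul_sum, ← sum_add_distrib]
      rw [Fintype.sum_prod_type, Fintype.sum_bool, Fintype.sum_prod_type]
      simp only [true_and, Bool.false_eq_true, false_and, if_false, sum_const_zero, add_zero]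
      rw [sum_eq_single p (fun q _ hq => by simp [hq]) (by simp)]
      simp
    rw [hsum, inner_eq_sum, inner_eq_sum, ← sum_sub_distrib]
    refine (norm_sum_le _ _).trans (sum_le_sum fun b _ => ?_)
    have amgm : 2 * (‖ψ b‖ * ‖φ b‖) ≤ a * ‖φ b‖ ^ 2 + a⁻¹ * ‖ψ b‖ ^ 2 := by
      have h1 : a * ‖φ b‖ ^ 2 + a⁻¹ * ‖ψ b‖ ^ 2 - 2 * (‖ψ b‖ * ‖φ b‖) =
          a * (‖φ b‖ - a⁻¹ * ‖ψ b‖) ^ 2 := by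
        field_simp
        ring
      nlinarith [mul_nonneg ha.le (sq_nonneg (‖φ b‖ - a⁻¹ * ‖ψ b‖))]
    by_cases hb : b.1 = true ∧ b.2.1 = p
    · rw [if_pos hb]
      refine (norm_sub_le _ _).trans (le_trans (le_of_eq ?_) amgm)
      simp only [query, norm_mul, RCLike.norm_conj]
      split_ifs <;> simp <;> ring
    · rw [if_neg hb]
      refine le_of_eq (norm_eq_zero.2 ?_)
      have hs : (b.1 && f b.2.1) = (b.1 && g b.2.1) := by
        by_cases h1 : b.1 = true
        · rw [hfg _ fun h2 => hb ⟨h1, h2⟩]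
        · simp [h1]
      simp only [query, hs]
      split_ifs <;> simp
  have := norm_sub_norm_le (inner ℂ φ ψ) (inner ℂ (query f φ) (query g ψ))
  linarith

theorem QueryAlgorithm.one_le_norm_inner_add (A : QueryAlgorithm N K)
    {f g : Fin N × Fin K → Bool} {p : Fin N × Fin K} (hfg : ∀ q, q ≠ p → f q = g q)
    {a : ℝ} (ha : 0 < a) (T : ℕ) :
    1 ≤ ‖inner ℂ (A.stateAfter f T) (A.stateAfter g T)‖ +
      ∑ t ∈ range T, (a * queryMass (A.stateAfter f t) p +
        a⁻¹ * queryMass (A.stateAfter g t) p) := by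
  induction T with
  | zero =>
    have h : A.stateAfter f 0 = A.stateAfter g 0 := rfl
    rw [h, inner_self_eq_norm_sq_to_K, A.norm_stateAfter]
    simp
  | succ T ih =>
    have h := norm_inner_le_query hfg (A.stateAfter f T) (A.stateAfter g T) ha
    rw [sum_range_succ]
    simp only [QueryAlgorithm.stateAfter, LinearIsometryEquiv.inner_map_map] at ih ⊢
    linarith

/-- States that a measurement distinguishes with error at most `1/3` are far from parallel. -/
theorem norm_inner_le_of_distinguished {φ ψ : State N K d} (hφ : ‖φ‖ = 1) (hψ : ‖ψ‖ = 1)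
    (S : Finset (BasisState N K d)) (h₁ : 2 / 3 ≤ ∑ b ∈ S, ‖φ b‖ ^ 2)
    (h₂ : 2 / 3 ≤ ∑ b ∈ Sᶜ, ‖ψ b‖ ^ 2) : ‖inner ℂ φ ψ‖ ≤ 17 / 18 := by
  have e₁ := norm_sq_eq_one_sum hφ
  have e₂ := norm_sq_eq_one_sum hψ
  rw [← sum_add_sum_compl S] at e₁ e₂
  -- Weighted AM-GM: the weights 1/3 and 3/4 have product 1/4. The smaller weight goes to the state
  -- concentrated on the set, so each state contributes at most 1/3 + (5/12)(1/3) = 17/36.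
  have b₁ : ∑ b ∈ S, ‖ψ b * (starRingEnd ℂ) (φ b)‖ ≤
      ∑ b ∈ S, (1 / 3 * ‖φ b‖ ^ 2 + 3 / 4 * ‖ψ b‖ ^ 2) := by
    refine sum_le_sum fun b _ => ?_
    rw [norm_mul, RCLike.norm_conj]
    nlinarith [sq_nonneg (2 * ‖φ b‖ - 3 * ‖ψ b‖)]
  have b₂ : ∑ b ∈ Sᶜ, ‖ψ b * (starRingEnd ℂ) (φ b)‖ ≤
      ∑ b ∈ Sᶜ, (3 / 4 * ‖φ b‖ ^ 2 + 1 / 3 * ‖ψ b‖ ^ 2) := by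
    refine sum_le_sum fun b _ => ?_
    rw [norm_mul, RCLike.norm_conj]
    nlinarith [sq_nonneg (3 * ‖φ b‖ - 2 * ‖ψ b‖)]
  rw [sum_add_distrib, ← mul_sum, ← mul_sum] at b₁ b₂
  rw [inner_eq_sum]
  refine (norm_sum_le _ _).trans ?_
  rw [← sum_add_sum_compl S]
  linarith

/-! ### Hard inputs -/

/-- The input whose column `j` has a single zero, in row `y j`. -/
def oneZeroPerColumn (y : Fin K → Fin N) : Fin N × Fin K → Bool :=
  fun q => decide (q.1 ≠ y q.2)

/-- `oneZeroPerColumn y` with the zero of column `k` replaced by a one. -/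
def filledColumn (y : Fin K → Fin N) (k : Fin K) : Fin N × Fin K → Bool :=
  fun q => decide (q.2 = k ∨ q.1 ≠ y q.2)

theorem filledColumn_eq_oneZeroPerColumn (y : Fin K → Fin N) (k : Fin K) {q : Fin N × Fin K}
    (hq : q ≠ (y k, k)) : filledColumn y k q = oneZeroPerColumn y q := by
  obtain ⟨i, j⟩ := q
  by_cases hj : j = k
  · subst hj
    have hi : i ≠ y j := fun h => hq (by rw [h])
    simp [filledColumn, oneZeroPerColumn, hi]
  · simp [filledColumn, oneZeroPerColumn, hj]

theorem filledColumn_update (y : Fin K → Fin N) (k : Fin K) (i : Fin N) :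
    filledColumn (Function.update y k i) k = filledColumn y k := by
  funext q
  by_cases hq : q.2 = k <;> simp [filledColumn, hq]

theorem mem_correctAnswers_oneZeroPerColumn {y : Fin K → Fin N} {r : Option (Fin K)}
    (hr : r ∈ correctAnswers (oneZeroPerColumn y)) : r = none := by
  rcases r with _ | j
  · rfl
  · have h : ∀ i, oneZeroPerColumn y (i, j) = true := hr
    simpa [oneZeroPerColumn] using h (y j)

theorem none_notMem_correctAnswers_filledColumn (y : Fin K → Fin N) (k : Fin K) :
    none ∉ correctAnswers (filledColumn y k) := by
  intro h
  have h' : ¬ ∃ j, ∀ i, filledColumn y k (i, j) = true := h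
  exact h' ⟨k, fun i => by simp [filledColumn]⟩

theorem QueryAlgorithm.norm_inner_final_le (A : QueryAlgorithm N K)
    (hA : SolvesMultiCriterionSearch A) (y : Fin K → Fin N) (k : Fin K) :
    ‖inner ℂ (A.stateAfter (filledColumn y k) A.queries)
      (A.stateAfter (oneZeroPerColumn y) A.queries)‖ ≤ 17 / 18 := by
  classical
  refine norm_inner_le_of_distinguished (A.norm_stateAfter _ _) (A.norm_stateAfter _ _)
    {b | A.readout b ≠ none} ((hA (filledColumn y k)).trans ?_)
    ((hA (oneZeroPerColumn y)).trans ?_)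
  · refine sum_le_sum_of_subset_of_nonneg (fun b hb => ?_) fun _ _ _ => sq_nonneg _
    simp only [mem_filter, mem_univ, true_and] at hb ⊢
    exact fun h => none_notMem_correctAnswers_filledColumn y k (h ▸ hb)
  · refine sum_le_sum_of_subset_of_nonneg (fun b hb => ?_) fun _ _ _ => sq_nonneg _
    simp only [mem_filter, mem_univ, true_and, mem_compl, not_not] at hb ⊢
    exact mem_correctAnswers_oneZeroPerColumn hb

/-! ### Averaging over the positions of the zeros -/

theorem sum_sum_update {ι α : Type*} [Fintype ι] [DecidableEq ι] [Fintype α]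
    (k : ι) (h : (ι → α) → ℝ) :
    ∑ y, ∑ i, h (Function.update y k i) = Fintype.card α * ∑ y, h y := by
  -- Swapping the fresh value with coordinate `k` permutes the pairs, so resampling a coordinate
  -- preserves the uniform measure.
  have hinv : Function.Involutive
      (fun z : (ι → α) × α => (Function.update z.1 k z.2, z.1 k)) := fun z => by simp
  calc ∑ y, ∑ i, h (Function.update y k i)
      = ∑ z : (ι → α) × α, h (Function.update z.1 k z.2) := by rw [Fintype.sum_prod_type]
    _ = ∑ z : (ι → α) × α, h z.1 := Equiv.sum_comp hinv.toPerm fun z => h z.1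
    _ = _ := by
      rw [Fintype.sum_prod_type]
      simp [mul_sum]

theorem QueryAlgorithm.sum_queryMass_oneZeroPerColumn_le (A : QueryAlgorithm N K) (t : ℕ) :
    ∑ y, ∑ k, queryMass (A.stateAfter (oneZeroPerColumn y) t) (y k, k) ≤
      Fintype.card (Fin K → Fin N) := by
  refine (sum_le_sum fun y _ => sum_queryMass_comp_le (A.norm_stateAfter _ t)
    (e := fun k => (y k, k)) fun _ _ h => (Prod.ext_iff.1 h).2).trans ?_
  simp

/-- The filled input does not depend on `y k`, so for fixed `k` resampling `y k` spreads one unit of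
mass over the `N` entries of column `k`. -/
theorem QueryAlgorithm.sum_queryMass_filledColumn_le (A : QueryAlgorithm N K) (t : ℕ) :
    N * ∑ y, ∑ k, queryMass (A.stateAfter (filledColumn y k) t) (y k, k) ≤
      K * Fintype.card (Fin K → Fin N) := by
  rw [sum_comm, mul_sum]
  have hk : ∀ k : Fin K,
      N * ∑ y, queryMass (A.stateAfter (filledColumn y k) t) (y k, k) ≤
        Fintype.card (Fin K → Fin N) := fun k => by
    have h := sum_sum_update k
      fun y => queryMass (A.stateAfter (filledColumn y k) t) (y k, k)
    simp only [filledColumn_update, Function.update_self, Fintype.card_fin] at h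
    rw [← h]
    refine (sum_le_sum fun y _ => sum_queryMass_comp_le (A.norm_stateAfter _ t)
      (e := fun i => (i, k)) fun _ _ h => (Prod.ext_iff.1 h).1).trans ?_
    simp
  refine (sum_le_sum fun k _ => hk k).trans ?_
  simp

theorem QueryAlgorithm.candidates_le_queries_mul (A : QueryAlgorithm N K)
    (hA : SolvesMultiCriterionSearch A) (hN : 0 < N) {a : ℝ} (ha : 0 < a) :
    (K : ℝ) / 18 ≤ A.queries * (a * (K / N) + a⁻¹) := by
  have hN' : (0 : ℝ) < N := by exact_mod_cast hN
  have : Nonempty (Fin K → Fin N) := ⟨fun _ => ⟨0, hN⟩⟩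
  set M : ℝ := ((Fintype.card (Fin K → Fin N) : ℕ) : ℝ) with hM
  have hM0 : 0 < M := Nat.cast_pos.2 Fintype.card_pos
  have pair : ∀ (y : Fin K → Fin N) (k : Fin K), (1 : ℝ) / 18 ≤
      ∑ t ∈ range A.queries, (a * queryMass (A.stateAfter (filledColumn y k) t) (y k, k) +
        a⁻¹ * queryMass (A.stateAfter (oneZeroPerColumn y) t) (y k, k)) := fun y k => by
    have h₁ := A.one_le_norm_inner_add
      (fun q hq => filledColumn_eq_oneZeroPerColumn y k hq) ha A.queries
    have h₂ := A.norm_inner_final_le hA y k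
    linarith
  have total := sum_le_sum fun (y : Fin K → Fin N) (_ : y ∈ univ) =>
    sum_le_sum fun (k : Fin K) (_ : k ∈ univ) => pair y k
  have hswap : ∀ F : (Fin K → Fin N) → Fin K → ℕ → ℝ,
      ∑ y, ∑ k, ∑ t ∈ range A.queries, F y k t = ∑ t ∈ range A.queries, ∑ y, ∑ k, F y k t :=
    fun F => by
      rw [sum_comm]
      simp_rw [sum_comm (s := univ) (t := range A.queries)]
      refine sum_congr rfl fun t _ => sum_comm
  rw [hswap] at total
  have bound : ∀ t ∈ range A.queries,
      ∑ y, ∑ k, (a * queryMass (A.stateAfter (filledColumn y k) t) (y k, k) +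
        a⁻¹ * queryMass (A.stateAfter (oneZeroPerColumn y) t) (y k, k)) ≤
      M * (a * (K / N) + a⁻¹) := fun t _ => by
    simp only [sum_add_distrib, ← mul_sum]
    have h₁ : ∑ y, ∑ k, queryMass (A.stateAfter (filledColumn y k) t) (y k, k) ≤
        K / N * M := by
      rw [div_mul_eq_mul_div, le_div_iff₀ hN', mul_comm _ (N : ℝ)]
      exact A.sum_queryMass_filledColumn_le t
    have h₂ := mul_le_mul_of_nonneg_left (A.sum_queryMass_oneZeroPerColumn_le t)
      (inv_pos.2 ha).le
    have h₃ := mul_le_mul_of_nonneg_left h₁ ha.le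
    rw [← hM] at h₂
    linarith
  have h := total.trans (sum_le_sum bound)
  simp only [sum_const, card_univ, card_range, nsmul_eq_mul, Fintype.card_fin, ← hM] at h
  refine le_of_mul_le_mul_left ?_ hM0
  linarith

end MultiCriterion

theorem lemma2 :
    ∃ c : ℝ, 0 < c ∧ ∀ (N K : ℕ) (A : MultiCriterion.QueryAlgorithm N K),
      MultiCriterion.SolvesMultiCriterionSearch A →
        c * √((N : ℝ) * (K : ℝ)) ≤ (A.queries : ℝ) := by
  refine ⟨1 / 36, by norm_num, fun N K A hA => ?_⟩
  rcases Nat.eq_zero_or_pos N with rfl | hN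
  · simp
  rcases Nat.eq_zero_or_pos K with rfl | hK
  · simp
  have hn : 0 < √(N : ℝ) := Real.sqrt_pos.2 (by exact_mod_cast hN)
  have hk : 0 < √(K : ℝ) := Real.sqrt_pos.2 (by exact_mod_cast hK)
  -- The choice `a = √N / √K` makes both terms equal to `√K / √N`; the resulting factor 2 turns 1/18
  -- into 1/36.
  have h := A.candidates_le_queries_mul hA hN (div_pos hn hk)
  have hn2 := Real.sq_sqrt (Nat.cast_nonneg (α := ℝ) N)
  have hk2 := Real.sq_sqrt (Nat.cast_nonneg (α := ℝ) K)
  rw [Real.sqrt_mul (Nat.cast_nonneg N)]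
  have e : √(N : ℝ) / √(K : ℝ) * (K / N) + (√(N : ℝ) / √(K : ℝ))⁻¹ =
      2 * (√(K : ℝ) / √(N : ℝ)) := by
    rw [← hn2, ← hk2, Real.sqrt_sq hn.le, Real.sqrt_sq hk.le]
    field_simp
    ring
  rw [e] at h
  have h' := mul_le_mul_of_nonneg_right h (div_pos hn hk).le
  have e₁ : (A.queries : ℝ) * (2 * (√(K : ℝ) / √(N : ℝ))) * (√(N : ℝ) / √(K : ℝ)) =
      2 * A.queries := by
    field_simp
  have e₂ : (K : ℝ) / 18 * (√(N : ℝ) / √(K : ℝ)) = √(N : ℝ) * √(K : ℝ) / 18 := by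
    nth_rewrite 1 [← hk2]
    field_simp
  rw [e₁, e₂] at h'
  linarith
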